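/- For a finite set $Y\subset\mathbb{R}^2$ of points (clients) and $t\in\mathbb{R}$, let $c(t)$ denote the minimum of $\sum_i r_i$ over all finite families of closed Euclidean disks, with radii $r_i\ge 0$ and centers on the horizontal line $y=t$, that together cover $Y$ (the number of disks is not restricted). Let $Y$ be the five-point set $$Y=\{(3,4),\,(-3,-2),\,(102,2),\,(98,-2),\,(200,2)\}.$$ Then the minimum $c(t)$ is attained for every $t\in\mathbb{R}$, and the function $c$ has a unique minimizer $t_0$ over $\mathbb{R}$. The number $t_0$ is not expressible by radicals: it does not lie in the smallest subfield of $\mathbb{C}$ that is closed under taking $n$-th roots for all $n\ge 1$ (that is, which contains $z$ whenever it contains $z^n$ for some $n\ge1$). Moreover $t_0$ is a root of the polynomial $$f(y)=1024+512y-1600y^2+1536y^3-960y^4+368y^5-172y^6+28y^7-7y^8,$$ which has degree $8$ and whose Galois group over $\mathbb{Q}$ is isomorphic to the symmetric group $S_8$. -/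

import Mathlib

noncomputable section

namespace HorizontalLineCover

/-- The Euclidean plane; `p 0` is the `x`-coordinate and `p 1` the `y`-coordinate of `p`. -/
abbrev Plane : Type := EuclideanSpace ℝ (Fin 2)

/-- `D` is a finite family of disks (a pair `(s, r)` stands for the closed disk with center `s` and
radius `r`) whose centers lie on the horizontal line `y = t` and which together cover all the
clients in `Y`. The number of disks is not restricted. -/
structure IsCover (Y : Set Plane) (t : ℝ) (D : Finset (Plane × ℝ)) : Prop where
  radius_nonneg : ∀ d ∈ D, 0 ≤ d.2
  center_on_line : ∀ d ∈ D, d.1 1 = t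
  covers : ∀ p ∈ Y, ∃ d ∈ D, dist d.1 p ≤ d.2

/-- The costs (sums of radii) of all the covers of `Y` whose centers lie on the line `y = t`. -/
def coverCosts (Y : Set Plane) (t : ℝ) : Set ℝ :=
  {c | ∃ D : Finset (Plane × ℝ), IsCover Y t D ∧ c = ∑ d ∈ D, d.2}

/-- `c(t)`: the minimum cost of a cover of `Y` whose centers lie on the line `y = t`. -/
def minCost (Y : Set Plane) (t : ℝ) : ℝ := sInf (coverCosts Y t)

/-- The five clients. -/
def clients : Set Plane :=
  {!₂[3, 4], !₂[-3, -2], !₂[102, 2], !₂[98, -2], !₂[200, 2]}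

open Polynomial in
/-- The polynomial of degree 8 that has the optimal height as a root. -/
def heightPoly : ℚ[X] :=
  1024 + 512 * X - 1600 * X ^ 2 + 1536 * X ^ 3 - 960 * X ^ 4
    + 368 * X ^ 5 - 172 * X ^ 6 + 28 * X ^ 7 - 7 * X ^ 8

end HorizontalLineCover

end

/-! Geometry. The clients form three clusters, near x = 0, 100 and 200, so far apart that a disk
meeting two of them is too expensive. For heights in [-2, 2] the cheapest cover spends one disk on
each cluster, centered for the two pairs on the perpendicular bisector; this gives `heightCost`. At
every other height a cover costs at least 8.4, more than `heightCost (7 / 5)`. Since `heightCost` is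
strictly convex, its critical point is the unique minimizer, and squaring the critical equation
twice gives `heightPoly`.

Algebra. After scaling to a monic integral polynomial, reduction modulo 5 gives two quartics without
roots in the fields of 5, 25 and 125 elements, and reduction modulo 11 gives factors of degrees 1, 2
and 5. The Frobenius elements supply a Galois permutation without cycles of length at most 3 and one
of cycle type (1, 2, 5). By `Equiv.Perm.eq_top_of_card_eq_eight` these force the full symmetric
group, which yields irreducibility and, as S_8 is not solvable, the failure of radicals. -/

/-! ### Generating the symmetric group of degree 8 -/

/-- As 5 is prime, a moved point has period exactly 5 under `g`. This is applied both to points and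
to blocks. -/
theorem five_le_ncard_orbit_of_pow_five {G X : Type*} [Group G] [MulAction G X] [Finite X] {g : G}
    (hg : g ^ 5 = 1) {x : X} (hx : g • x ≠ x) : 5 ≤ (MulAction.orbit G x).ncard := by
  have : Fact (Nat.Prime 5) := ⟨by norm_num⟩
  have h5 : Function.minimalPeriod (g • · : X → X) x = 5 := by
    apply Function.minimalPeriod_eq_prime
    · rw [Function.IsPeriodicPt, Function.IsFixedPt, smul_iterate, hg]
      exact one_smul G x
    · exact hx
  have hc : Nat.card (MulAction.orbit (Subgroup.zpowers g) x) = 5 := by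
    rw [Nat.card_congr (MulAction.orbitZPowersEquiv g x), h5, Nat.card_zmod]
  rw [← hc, Nat.card_coe_set_eq]
  exact Set.ncard_le_ncard (MulAction.orbit_subgroup_subset _ _) (Set.toFinite _)

-- The element `v ^ 2` has order 5, which gives an orbit too large to leave room for a cycle of `u`
-- outside it, and blocks that are either too large or too numerous to be nontrivial. Jordan's
-- theorem on primitive groups containing a transposition then applies.
open scoped Pointwise in
theorem Equiv.Perm.eq_top_of_card_eq_eight {X : Type*} [DecidableEq X] (hX : Nat.card X = 8)
    (G : Subgroup (Equiv.Perm X)) {u v : Equiv.Perm X} (hu : u ∈ G) (hv : v ∈ G)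
    (hu1 : ∀ x, u x ≠ x) (hu2 : ∀ x, u (u x) ≠ x) (hu3 : ∀ x, u (u (u x)) ≠ x)
    (hswap : (v ^ 5).IsSwap) (hmove : ∃ a, (v ^ 2) a ≠ a) :
    G = ⊤ := by
  have : Finite X := Nat.finite_of_card_ne_zero (by omega)
  obtain ⟨a, ha⟩ := hmove
  let c : G := ⟨v, hv⟩ ^ 2
  have hc : c ^ 5 = 1 := by
    ext1
    obtain ⟨y, z, -, h⟩ := hswap
    calc (v ^ 2) ^ 5 = v ^ 5 * v ^ 5 := by group
      _ = 1 := by rw [h, Equiv.swap_mul_self]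
  have hca : c • a ≠ a := ha
  have horb := five_le_ncard_orbit_of_pow_five hc hca
  have htrans : MulAction.IsPretransitive G X := by
    rw [MulAction.isPretransitive_iff_orbit_eq_univ a]
    rw [Set.eq_univ_iff_forall]
    -- The complement of the orbit has at most 3 points, but it is stable under `u`, so it would
    -- contain four distinct ones.
    by_contra! h
    obtain ⟨x, hx⟩ := h
    have hstep : ∀ y, y ∉ MulAction.orbit G a → u y ∉ MulAction.orbit G a := by
      intro y hy hy'
      apply hy
      have := MulAction.mem_orbit_of_mem_orbit (⟨u, hu⟩⁻¹ : G) hy'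
      change u⁻¹ (u y) ∈ _ at this
      simpa using this
    have h1 := hstep _ hx
    have h2 := hstep _ h1
    have h3 := hstep _ h2
    have hsub : ({x, u x, u (u x), u (u (u x))} : Set X) ⊆ (MulAction.orbit G a)ᶜ := by
      intro y hy
      simp only [Set.mem_insert_iff, Set.mem_singleton_iff] at hy
      rcases hy with rfl | rfl | rfl | rfl <;> assumption
    have hle := Set.ncard_le_ncard hsub (Set.toFinite _)
    have hcard : ({x, u x, u (u x), u (u (u x))} : Set X).ncard = 4 := by
      rw [Set.ncard_eq_toFinset_card']
      have e1 := hu1 x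
      have e2 := hu2 x
      have e3 := hu3 x
      have e4 := hu1 (u x)
      have e5 := hu2 (u x)
      have e6 := hu1 (u (u x))
      simp [Finset.card_insert_of_notMem, e1.symm, e2.symm, e3.symm, e4.symm, e5.symm, e6.symm]
    have := Set.ncard_add_ncard_compl (MulAction.orbit G a)
    omega
  refine Equiv.Perm.subgroup_eq_top_of_isPreprimitive_of_isSwap_mem ?_ _ hswap (pow_mem hv 5)
  apply MulAction.IsPreprimitive.of_isTrivialBlock_base a
  intro B haB hB
  -- If `c` fixes the block, the block contains at least 5 of the 8 points; otherwise it has at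
  -- least 5 translates, so it has at most one point.
  by_cases hcB : c • B = B
  · right
    apply hB.eq_univ_of_card_lt
    have hsub : MulAction.orbit (Subgroup.zpowers c) a ⊆ B := by
      rintro _ ⟨⟨g, n, rfl⟩, rfl⟩
      have : c ^ n ∈ MulAction.stabilizer G B := zpow_mem (by exact hcB) n
      have h := Set.smul_mem_smul_set (a := c ^ n) haB
      rwa [MulAction.mem_stabilizer_iff.mp this] at h
    have h5 := five_le_ncard_orbit_of_pow_five (G := Subgroup.zpowers c)
      (g := ⟨c, Subgroup.mem_zpowers c⟩) (x := a) (by ext1; exact hc) hca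
    have := Set.ncard_le_ncard hsub (Set.toFinite _)
    omega
  · left
    apply hB.subsingleton_of_card_lt
    have := five_le_ncard_orbit_of_pow_five hc hcB
    omega

/-! ### Frobenius elements -/

-- Here `π` is reduction modulo a prime of the ring of integers above `p`, and `σ` is an arithmetic
-- Frobenius there. Ramification is harmless, since only existence is used.
open NumberField in
theorem NumberField.exists_frobenius (L : Type) [Field L] [Algebra ℚ L] [FiniteDimensional ℚ L]
    [IsGalois ℚ L]
    (p : ℕ) [Fact p.Prime] :
    ∃ (K : Type) (_ : Field K) (_ : CharP K p) (π : 𝓞 L →+* K) (σ : L ≃ₐ[ℚ] L),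
      ∀ x y : 𝓞 L, (y : L) = σ x → π y = π x ^ p := by
  have : CharZero L := algebraRat.charZero L
  obtain rfl : ‹Algebra ℚ L› = DivisionRing.toRatAlgebra := Subsingleton.elim _ _
  have : NumberField L := ⟨⟩
  have hp : (p : ℤ) ≠ 0 := by exact_mod_cast (Fact.out : p.Prime).ne_zero
  let P : Ideal ℤ := Ideal.span {(p : ℤ)}
  have hpP : (p : ℤ) ∈ P := Ideal.mem_span_singleton_self _
  have hP : P.IsMaximal := Int.ideal_span_isMaximal_of_prime p
  obtain ⟨Q, hQm, hQ⟩ := Ideal.exists_maximal_ideal_liesOver_of_isIntegral (S := 𝓞 L) P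
  have hunder : Q.under ℤ = P := hQ.over.symm
  have hpQ : (p : 𝓞 L) ∈ Q := by
    rw [← hunder, Ideal.under_def, Ideal.mem_comap] at hpP
    simpa using hpP
  have hQ0 : Q ≠ ⊥ := by
    rintro rfl
    rw [Ideal.mem_bot] at hpQ
    exact hp (by exact_mod_cast hpQ)
  have : Finite (𝓞 L ⧸ Q) := Ring.HasFiniteQuotients.finiteQuotient hQ0
  have : Algebra.IsInvariant ℤ (𝓞 L) (𝓞 L ≃ₐ[ℤ] 𝓞 L) :=
    Algebra.isInvariant_of_isGalois' ℤ ℚ L (𝓞 L)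
  have : Finite (𝓞 L ≃ₐ[ℤ] 𝓞 L) := Finite.of_equiv _ (galRestrict ℤ ℚ L (𝓞 L)).toEquiv
  obtain ⟨τ, hτ⟩ := IsArithFrobAt.exists_of_isInvariant ℤ (𝓞 L ≃ₐ[ℤ] 𝓞 L) Q
  let : Field (𝓞 L ⧸ Q) := Ideal.Quotient.field Q
  have hchar : CharP (𝓞 L ⧸ Q) p := by
    refine (CharP.charP_iff_prime_eq_zero (Fact.out : p.Prime)).mpr ?_
    rw [← map_natCast (Ideal.Quotient.mk Q), Ideal.Quotient.eq_zero_iff_mem]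
    exact hpQ
  refine ⟨𝓞 L ⧸ Q, inferInstance, hchar, Ideal.Quotient.mk Q, (galRestrict ℤ ℚ L (𝓞 L)).symm τ,
    fun x y h ↦ ?_⟩
  have hy : y = τ x := by
    apply FaithfulSMul.algebraMap_injective (𝓞 L) L
    exact h.trans (galRestrict_symm_algebraMap_apply (A := ℤ) ℚ (L := L) (B := 𝓞 L) τ x)
  have h := hτ.mk_apply x
  rw [hunder, Int.card_ideal_quot] at h
  rw [hy]
  exact h

/-! ### Certificates modulo 5 and 11 -/

/-- Since Frobenius is a ring homomorphism, each iterate reduces modulo the quartic to a cubic in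
`b`. Its difference from `b` is coprime to the quartic, as an explicit Bézout identity shows. The
next lemmas use the same method. -/
theorem iterate_pow_five_ne_of_left_quartic {K : Type*} [Field K] [CharP K 5] {b : K}
    (hb : b ^ 4 - 2 * b ^ 3 + b ^ 2 + 2 * b + 1 = 0) :
    (fun y : K ↦ y ^ 5)^[1] b ≠ b ∧
    (fun y : K ↦ y ^ 5)^[2] b ≠ b ∧
    (fun y : K ↦ y ^ 5)^[3] b ≠ b := by
  have : Fact (Nat.Prime 5) := ⟨by norm_num⟩
  have hp : (5 : K) = 0 := by exact_mod_cast CharP.cast_eq_zero K 5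
  have h1 : b ^ 5 = -2 * b ^ 3 + b ^ 2 - 2 := by
    linear_combination (b + 2) * hb + (b ^ 3 - b ^ 2 - b) * hp
  have h2 : (-2 * b ^ 3 + b ^ 2 - 2) ^ 5 = b ^ 3 - 2 * b ^ 2 + b + 2 := by
    rw [← frobenius_def 5]
    simp only [map_add, map_sub, map_neg, map_mul, map_pow, map_ofNat, frobenius_def]
    rw [h1]
    linear_combination (b ^ 5 - 2 * b ^ 4 + 2 * b ^ 3 - b ^ 2 + 2 * b + 1) * hb +
      (3 * b ^ 9 - 4 * b ^ 8 + b ^ 7 + 11 * b ^ 6 - 11 * b ^ 5 + 3 * b ^ 4 + 11 * b ^ 3 -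
      6 * b ^ 2 - b + 3) * hp
  have h3 : (b ^ 3 - 2 * b ^ 2 + b + 2) ^ 5 = b ^ 3 + b ^ 2 - 2 * b + 2 := by
    rw [← frobenius_def 5]
    simp only [map_add, map_sub, map_mul, map_pow, map_ofNat, frobenius_def]
    rw [h1]
    linear_combination (2 * b ^ 5 + b ^ 4 - b ^ 3 + 2 * b ^ 2 - 2 * b + 2) * hb +
      (-2 * b ^ 9 + 3 * b ^ 8 - b ^ 7 - 8 * b ^ 6 + 7 * b ^ 5 - 3 * b ^ 4 - 8 * b ^ 3 +
      4 * b ^ 2 - 4) * hp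
  refine ⟨?_, ?_, ?_⟩
  · intro h
    change b ^ 5 = b at h
    rw [h1] at h
    exact one_ne_zero (α := K) (by
      linear_combination (2 * b ^ 2 + 2 * b - 2) * hb + (b ^ 3 + 2 * b ^ 2 + b + 1)
        * h - (-b ^ 5 - b ^ 4 + b ^ 3 - b - 1) * hp)
  · intro h
    change (b ^ 5) ^ 5 = b at h
    rw [h1, h2] at h
    exact one_ne_zero (α := K) (by
      linear_combination (2 * b ^ 2 - b + 2) * hb + (-2 * b ^ 3 + b ^ 2 + b + 2) *
        h - (b ^ 4 - b ^ 3 + b + 1) * hp)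
  · intro h
    change ((b ^ 5) ^ 5) ^ 5 = b at h
    rw [h1, h2, h3] at h
    exact one_ne_zero (α := K) (by
      linear_combination (b ^ 2 - b) * hb + (-b ^ 3 - b ^ 2 - 2) * h - (-b ^ 5 +
        b ^ 4 - b ^ 2 + b - 1) * hp)

theorem iterate_pow_five_ne_of_right_quartic {K : Type*} [Field K] [CharP K 5] {b : K}
    (hb : b ^ 4 - 2 * b ^ 3 + b ^ 2 - 2 * b - 2 = 0) :
    (fun y : K ↦ y ^ 5)^[1] b ≠ b ∧
    (fun y : K ↦ y ^ 5)^[2] b ≠ b ∧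
    (fun y : K ↦ y ^ 5)^[3] b ≠ b := by
  have : Fact (Nat.Prime 5) := ⟨by norm_num⟩
  have hp : (5 : K) = 0 := by exact_mod_cast CharP.cast_eq_zero K 5
  have h1 : b ^ 5 = -2 * b ^ 3 + b - 1 := by
    linear_combination (b + 2) * hb + (b ^ 3 + b + 1) * hp
  have h2 : (-2 * b ^ 3 + b - 1) ^ 5 = b ^ 3 - b ^ 2 - 1 := by
    rw [← frobenius_def 5]
    simp only [map_add, map_sub, map_neg, map_mul, map_pow, map_ofNat, map_one, frobenius_def]
    rw [h1]
    linear_combination (b ^ 5 + 2 * b ^ 4 - b ^ 3 + 2 * b ^ 2 - 2 * b + 2) * hb +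
      (3 * b ^ 9 - 4 * b ^ 7 + 4 * b ^ 6 + 5 * b ^ 5 - 6 * b ^ 4 + 3 * b ^ 3 + b ^ 2 - b + 1)
      * hp
  have h3 : (b ^ 3 - b ^ 2 - 1) ^ 5 = b ^ 3 + b ^ 2 - 2 * b - 1 := by
    rw [← frobenius_def 5]
    simp only [map_sub, map_pow, map_one, frobenius_def]
    rw [h1]
    linear_combination (2 * b ^ 5 - b ^ 4 - 2 * b ^ 3 - 2 * b + 1) * hb + (-2 * b ^ 9 +
      b ^ 8 + 2 * b ^ 7 - 3 * b ^ 6 + b ^ 4 - 2 * b ^ 3 - 2 * b ^ 2 + b) * hp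
  refine ⟨?_, ?_, ?_⟩
  · intro h
    change b ^ 5 = b at h
    rw [h1] at h
    exact one_ne_zero (α := K) (by
      linear_combination (2 * b ^ 2 - b + 2) * hb + (b ^ 3 - 2 * b) * h - (-b ^ 5 +
        2 * b ^ 4 - 2 * b ^ 3 - 1) * hp)
  · intro h
    change (b ^ 5) ^ 5 = b at h
    rw [h1, h2] at h
    exact one_ne_zero (α := K) (by
      linear_combination (2 * b ^ 2 + 2 * b - 2) * hb + (-2 * b ^ 3 + 2 * b - 2) * h
        - (-2 * b ^ 2 + 1) * hp)
  · intro h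
    change ((b ^ 5) ^ 5) ^ 5 = b at h
    rw [h1, h2, h3] at h
    exact one_ne_zero (α := K) (by
      linear_combination (b ^ 2 - b) * hb + (-b ^ 3 - b ^ 2 - 1) * h - (-b ^ 5 +
        b ^ 4 + b) * hp)

theorem iterate_pow_eleven_of_quadratic {K : Type*} [Field K] [CharP K 11] {b : K}
    (hb : b ^ 2 + 5 * b + 1 = 0) :
    (fun y : K ↦ y ^ 11)^[2] b = b ∧
    (fun y : K ↦ y ^ 11)^[1] b ≠ b := by
  have : Fact (Nat.Prime 11) := ⟨by norm_num⟩
  have hp : (11 : K) = 0 := by exact_mod_cast CharP.cast_eq_zero K 11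
  have h1 : b ^ 11 = -b - 5 := by
    linear_combination (b ^ 9 - 5 * b ^ 8 + 2 * b ^ 7 - 5 * b ^ 6 + b ^ 5 - b ^ 3 +
      5 * b ^ 2 - 2 * b + 5) * hb + (2 * b ^ 9 + 2 * b ^ 7 - 2 * b ^ 3 - 2 * b) * hp
  have h2 : (-b - 5) ^ 11 = b := by
    rw [← frobenius_def 11]
    simp only [map_sub, map_neg, map_ofNat, frobenius_def]
    rw [h1]
    ring
  refine ⟨?_, ?_⟩
  · change (b ^ 11) ^ 11 = b
    rw [h1, h2]
  · intro h
    change b ^ 11 = b at h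
    rw [h1] at h
    exact one_ne_zero (α := K) (by
      linear_combination (4) * hb + (2 * b + 5) * h - (-2) * hp)

theorem iterate_pow_eleven_of_quintic {K : Type*} [Field K] [CharP K 11] {b : K}
    (hb : b ^ 5 - 3 * b ^ 4 - 5 * b ^ 3 - 4 * b - 4 = 0) :
    (fun y : K ↦ y ^ 11)^[5] b = b ∧
    (fun y : K ↦ y ^ 11)^[2] b ≠ b := by
  have : Fact (Nat.Prime 11) := ⟨by norm_num⟩
  have hp : (11 : K) = 0 := by exact_mod_cast CharP.cast_eq_zero K 11
  have h1 : b ^ 11 = 3 * b ^ 3 - 2 * b ^ 2 + b + 4 := by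
    linear_combination (b ^ 6 + 3 * b ^ 5 + 3 * b ^ 4 + 2 * b ^ 3 + 3 * b ^ 2 + 2 * b + 1)
      * hb + (b ^ 9 + 2 * b ^ 8 + 2 * b ^ 7 + 3 * b ^ 6 + 4 * b ^ 5 + 3 * b ^ 4 + 2 * b ^ 3 +
      2 * b ^ 2 + b) * hp
  have h2 : (3 * b ^ 3 - 2 * b ^ 2 + b + 4) ^ 11 = -5 * b ^ 4 + 3 * b ^ 3 - 4 * b ^ 2 + 5 * b + 4
    := by
    rw [← frobenius_def 11]
    simp only [map_add, map_sub, map_mul, map_pow, map_ofNat, frobenius_def]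
    rw [h1]
    linear_combination (4 * b ^ 4 + 4 * b ^ 3 + b ^ 2 - b + 3) * hb + (7 * b ^ 9 -
      14 * b ^ 8 + 20 * b ^ 7 + 18 * b ^ 6 - 30 * b ^ 5 + 33 * b ^ 4 + 26 * b ^ 3 - 20 * b ^ 2
      + 12 * b + 16) * hp
  have h3 : (-5 * b ^ 4 + 3 * b ^ 3 - 4 * b ^ 2 + 5 * b + 4) ^ 11 = 3 * b ^ 4 - b ^ 3 - 4 * b ^ 2
    + b + 5 := by
    rw [← frobenius_def 11]
    simp only [map_add, map_sub, map_neg, map_mul, map_pow, map_ofNat, frobenius_def]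
    rw [h1]
    linear_combination (2 * b ^ 7 - 3 * b ^ 6 - 2 * b ^ 5 - b ^ 4 + 3 * b ^ 3 + 3 * b ^ 2 +
      5 * b) * hb + (-37 * b ^ 12 + 99 * b ^ 11 - 147 * b ^ 10 - 49 * b ^ 9 + 280 * b ^ 8 -
      394 * b ^ 7 - 75 * b ^ 6 + 347 * b ^ 5 - 363 * b ^ 4 - 159 * b ^ 3 + 174 * b ^ 2 -
      104 * b - 103) * hp
  have h4 : (3 * b ^ 4 - b ^ 3 - 4 * b ^ 2 + b + 5) ^ 11 = 2 * b ^ 4 - 5 * b ^ 3 - b ^ 2 + 3 * b +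
    1 := by
    rw [← frobenius_def 11]
    simp only [map_add, map_sub, map_mul, map_pow, map_ofNat, frobenius_def]
    rw [h1]
    linear_combination (b ^ 7 + 4 * b ^ 6 - b ^ 5 - 2 * b ^ 4 - 3 * b ^ 2 - 4 * b + 3) *
      hb + (22 * b ^ 12 - 59 * b ^ 11 + 90 * b ^ 10 + 32 * b ^ 9 - 173 * b ^ 8 + 242 * b ^ 7
      + 45 * b ^ 6 - 213 * b ^ 5 + 220 * b ^ 4 + 94 * b ^ 3 - 103 * b ^ 2 + 62 * b + 60) *
      hp
  have h5 : (2 * b ^ 4 - 5 * b ^ 3 - b ^ 2 + 3 * b + 1) ^ 11 = b := by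
    rw [← frobenius_def 11]
    simp only [map_add, map_sub, map_mul, map_pow, map_ofNat, map_one, frobenius_def]
    rw [h1]
    linear_combination (-3 * b ^ 7 - b ^ 6 + 3 * b ^ 5 - b ^ 4 + 4 * b ^ 3 - b ^ 2 + 5) *
      hb + (15 * b ^ 12 - 40 * b ^ 11 + 57 * b ^ 10 + 10 * b ^ 9 - 94 * b ^ 8 + 135 * b ^ 7
      + 8 * b ^ 6 - 93 * b ^ 5 + 107 * b ^ 4 + 31 * b ^ 3 - 37 * b ^ 2 + 26 * b + 19) * hp
  refine ⟨?_, ?_⟩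
  · change ((((b ^ 11) ^ 11) ^ 11) ^ 11) ^ 11 = b
    rw [h1, h2, h3, h4, h5]
  · intro h
    change (b ^ 11) ^ 11 = b at h
    rw [h1, h2] at h
    exact one_ne_zero (α := K) (by
      linear_combination (-5 * b ^ 3 - 3 * b ^ 2 + 5 * b - 3) * hb + (-b ^ 4 +
        4 * b ^ 3 + 2 * b) * h - (-b ^ 7 + 5 * b ^ 6 - 3 * b ^ 5 + 2 * b ^ 4 + 5 * b ^ 3 +
        1) * hp)

theorem resolvent_factor_five {K : Type*} [Field K] [CharP K 5] (b : K) :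
    b ^ 8 - 14 * b ^ 7 + 301 * b ^ 6 - 2254 * b ^ 5 + 20580 * b ^ 4 - 115248 * b ^ 3
        + 420175 * b ^ 2 - 470596 * b - 3294172 =
      (b ^ 4 - 2 * b ^ 3 + b ^ 2 + 2 * b + 1) * (b ^ 4 - 2 * b ^ 3 + b ^ 2 - 2 * b - 2) := by
  have hp : (5 : K) = 0 := by exact_mod_cast CharP.cast_eq_zero K 5
  linear_combination (-2 * b ^ 7 + 59 * b ^ 6 - 450 * b ^ 5 + 4116 * b ^ 4 - 23050 * b ^ 3 +
    84036 * b ^ 2 - 94118 * b - 658834) * hp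

theorem resolvent_factor_eleven {K : Type*} [Field K] [CharP K 11] (b : K) :
    b ^ 8 - 14 * b ^ 7 + 301 * b ^ 6 - 2254 * b ^ 5 + 20580 * b ^ 4 - 115248 * b ^ 3
        + 420175 * b ^ 2 - 470596 * b - 3294172 =
      (b - 5) * (b ^ 2 + 5 * b + 1) * (b ^ 5 - 3 * b ^ 4 - 5 * b ^ 3 - 4 * b - 4) := by
  have hp : (11 : K) = 0 := by exact_mod_cast CharP.cast_eq_zero K 11
  linear_combination (-b ^ 7 + 30 * b ^ 6 - 211 * b ^ 5 + 1859 * b ^ 4 - 10479 * b ^ 3 +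
    38189 * b ^ 2 - 42792 * b - 299472) * hp

/-- Separability modulo 11, again by a Bézout identity; it keeps distinct roots distinct after
reduction. -/
theorem derivative_ne_zero_of_root {K : Type*} [Field K] [CharP K 11] {b : K}
    (hb : b ^ 8 - 14 * b ^ 7 + 301 * b ^ 6 - 2254 * b ^ 5 + 20580 * b ^ 4 - 115248 * b ^ 3 +
      420175 * b ^ 2 - 470596 * b - 3294172 = 0) :
    8 * b ^ 7 - 98 * b ^ 6 + 1806 * b ^ 5 - 11270 * b ^ 4 + 82320 * b ^ 3 - 345744 * b ^ 2 +
      840350 * b - 470596 ≠ 0 := by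
  intro h
  have hp : (11 : K) = 0 := by exact_mod_cast CharP.cast_eq_zero K 11
  exact one_ne_zero (α := K) (by
    linear_combination (-5 * b ^ 6 - b ^ 5 - 2 * b ^ 4 + 2 * b ^ 3 + 2 * b ^ 2 + 2 * b -
      5) * hb + (2 * b ^ 7 - 2 * b ^ 6 - 2 * b ^ 5 + b ^ 4 + 5 * b ^ 3 - 5 * b ^ 2 - 5 * b +
      4) * h - (b ^ 14 - 13 * b ^ 13 + 209 * b ^ 12 - 1359 * b ^ 11 + 7476 * b ^ 10 -
      24688 * b ^ 9 + 15912 * b ^ 8 + 26153 * b ^ 7 + 1389003 * b ^ 6 + 418404 * b ^ 5 +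
      1014300 * b ^ 4 - 964516 * b ^ 3 - 1169287 * b ^ 2 + 134456 * b + 1326225) * hp)

open Polynomial

theorem Polynomial.eval_derivative_map_eq_zero {R K : Type*} [CommRing R] [IsDomain R] [CommRing K]
    (π : R →+* K) (P : R[X]) {a b : R} (ha : P.IsRoot a) (hb : P.IsRoot b) (hab : a ≠ b)
    (h : π a = π b) : (derivative (P.map π)).eval (π a) = 0 := by
  obtain ⟨q, rfl⟩ := dvd_iff_isRoot.mpr ha
  have hq : q.eval b = 0 := by
    have hb' := hb
    rw [IsRoot, eval_mul, eval_sub, eval_X, eval_C] at hb'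
    exact (mul_eq_zero.mp hb').resolve_left (sub_ne_zero.mpr hab.symm)
  have hq' : (q.map π).eval (π a) = 0 := by rw [h, eval_map, eval₂_hom, hq, map_zero]
  simp [derivative_mul, hq']

/-! ### The Galois group of the height polynomial -/

namespace HorizontalLineCover

/-- The monic integral polynomial whose roots are `7 / 2` times the roots of `heightPoly`. -/
noncomputable def heightResolvent : ℤ[X] :=
  X ^ 8 - 14 * X ^ 7 + 301 * X ^ 6 - 2254 * X ^ 5 + 20580 * X ^ 4 - 115248 * X ^ 3
    + 420175 * X ^ 2 - 470596 * X - 3294172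

theorem heightResolvent_monic : heightResolvent.Monic := by
  unfold heightResolvent
  monicity!

theorem aeval_heightResolvent {K : Type*} [CommRing K] (b : K) : aeval b heightResolvent =
    b ^ 8 - 14 * b ^ 7 + 301 * b ^ 6 - 2254 * b ^ 5 + 20580 * b ^ 4 - 115248 * b ^ 3
      + 420175 * b ^ 2 - 470596 * b - 3294172 := by
  simp [heightResolvent, aeval_def]

theorem aeval_heightPoly {K : Type*} [Field K] [Algebra ℚ K] (b : K) : aeval b heightPoly =
    1024 + 512 * b - 1600 * b ^ 2 + 1536 * b ^ 3 - 960 * b ^ 4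
      + 368 * b ^ 5 - 172 * b ^ 6 + 28 * b ^ 7 - 7 * b ^ 8 := by
  simp [heightPoly, aeval_def]

theorem natDegree_heightPoly : heightPoly.natDegree = 8 := by
  unfold heightPoly
  compute_degree!

theorem heightPoly_ne_zero : heightPoly ≠ 0 := by
  intro h
  simpa [h] using natDegree_heightPoly

theorem derivative_heightPoly : derivative heightPoly =
    512 - 3200 * X + 4608 * X ^ 2 - 3840 * X ^ 3 + 1840 * X ^ 4 - 1032 * X ^ 5 + 196 * X ^ 6
      - 56 * X ^ 7 := by
  simp only [heightPoly, derivative_add, derivative_sub, derivative_mul, derivative_X_pow,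
    derivative_X, derivative_ofNat, C_ofNat, Nat.cast_ofNat, zero_mul, zero_add, mul_one]
  ring

theorem heightPoly_separable : heightPoly.Separable := by
  -- A Bézout identity between the polynomial and its derivative, with denominators cleared.
  have key : (171345293224 * X ^ 6 - 1163893022572 * X ^ 5 + 7617704898248 * X ^ 4
      - 16354031236656 * X ^ 3 + 58399647870912 * X ^ 2 - 19330253193216 * X
      + 149730101958016) * heightPoly
      + (-21418161653 * X ^ 7 + 156195708648 * X ^ 6 - 1119043350596 * X ^ 5
      + 3055048894880 * X ^ 4 - 11544135716992 * X ^ 3 + 10611555800192 * X ^ 2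
      - 41556289531584 * X + 11122128966400) * derivative heightPoly
      = C 159018154435805184 := by
    rw [derivative_heightPoly, heightPoly, C_ofNat]
    ring
  obtain ⟨c, hc⟩ := (isUnit_C (R := ℚ).mpr
    (show IsUnit (159018154435805184 : ℚ) by norm_num)).exists_left_inv
  rw [← key, mul_add, ← mul_assoc, ← mul_assoc] at hc
  exact ⟨_, _, hc⟩

section SplittingField

variable {L : Type} [Field L] [Algebra ℚ L]

-- The scaled roots are integral, so they can be reduced, and Frobenius on the roots becomes the
-- `p`-th power map. The last clause holds because two roots with the same reduction produce a
-- double root.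
open NumberField in
theorem exists_frobenius_on_roots [FiniteDimensional ℚ L] [IsGalois ℚ L] (p : ℕ) [Fact p.Prime] :
    ∃ (K : Type) (_ : Field K) (_ : CharP K p) (ρ : heightPoly.rootSet L → K) (σ : Gal(L/ℚ)),
      (∀ x, aeval (ρ x) heightResolvent = 0) ∧
      Function.Semiconj ρ (MulAction.toPermHom Gal(L/ℚ) (heightPoly.rootSet L) σ) (· ^ p) ∧
      ∀ x y, x ≠ y → ρ x = ρ y → aeval (ρ x) (derivative heightResolvent) = 0 := by
  obtain ⟨K, hK, hKp, π, σ, hσ⟩ := NumberField.exists_frobenius L p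
  have : CharZero L := algebraRat.charZero L
  have hroot (x : heightPoly.rootSet L) : aeval (7 / 2 * (x : L)) heightResolvent = 0 := by
    have hx := (mem_rootSet.mp x.2).2
    rw [aeval_heightPoly] at hx
    rw [aeval_heightResolvent]
    linear_combination (-(7 ^ 7) / 256 : L) * hx
  let β (x : heightPoly.rootSet L) : 𝓞 L :=
    ⟨7 / 2 * (x : L), heightResolvent, heightResolvent_monic, hroot x⟩
  have hβ (x) : aeval (β x) heightResolvent = 0 := by
    apply FaithfulSMul.algebraMap_injective (𝓞 L) L
    rw [← aeval_algebraMap_apply, map_zero]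
    exact hroot x
  refine ⟨K, hK, hKp, fun x ↦ π (β x), σ, fun x ↦ ?_, fun x ↦ ?_, fun x y hxy h ↦ ?_⟩
  · have h := congrArg π (hβ x)
    simp only [aeval_heightResolvent, map_sub, map_add, map_mul, map_pow, map_ofNat,
      map_zero] at h
    rw [aeval_heightResolvent]
    exact h
  · apply hσ
    change 7 / 2 * σ (x : L) = σ (7 / 2 * (x : L))
    rw [map_mul, map_div₀, map_ofNat, map_ofNat]
  · have key := eval_derivative_map_eq_zero π
      (heightResolvent.map (algebraMap ℤ (𝓞 L))) (a := β x) (b := β y)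
      (by rw [IsRoot, eval_map_algebraMap, hβ]) (by rw [IsRoot, eval_map_algebraMap, hβ]) ?_ h
    · rwa [map_map, RingHom.ext_int (π.comp _) (algebraMap ℤ K), derivative_map,
        eval_map_algebraMap] at key
    · intro h'
      apply hxy
      have h2 : 7 / 2 * (x : L) = 7 / 2 * (y : L) := congrArg (fun z : 𝓞 L ↦ (z : L)) h'
      ext1
      linear_combination (2 / 7 : L) * h2

/-- A root with a short period would reduce to an element fixed by that power of Frobenius;
injectivity of the reduction is not needed. -/
theorem exists_galois_without_short_cycles [FiniteDimensional ℚ L] [IsGalois ℚ L] :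
    ∃ σ : Gal(L/ℚ), ∀ x : heightPoly.rootSet L, ∀ k ∈ Finset.Icc 1 3,
      (MulAction.toPermHom Gal(L/ℚ) (heightPoly.rootSet L) σ ^ k) x ≠ x := by
  have : Fact (Nat.Prime 5) := ⟨by norm_num⟩
  obtain ⟨K, hK, hKp, ρ, σ, hρ, hσ, -⟩ := exists_frobenius_on_roots (L := L) 5
  refine ⟨σ, fun x k hk h ↦ ?_⟩
  have hx := hρ x
  rw [aeval_heightResolvent, resolvent_factor_five, mul_eq_zero] at hx
  have hk' := (hσ.iterate_right k) x
  rw [Equiv.Perm.iterate_eq_pow, h] at hk'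
  rw [Finset.mem_Icc] at hk
  obtain ⟨h1, h2, h3⟩ := hx.elim iterate_pow_five_ne_of_left_quartic
    iterate_pow_five_ne_of_right_quartic
  obtain rfl | rfl | rfl : k = 1 ∨ k = 2 ∨ k = 3 := by omega
  exacts [h1 hk'.symm, h2 hk'.symm, h3 hk'.symm]

theorem card_rootSet_heightPoly [IsSplittingField ℚ L heightPoly] :
    Nat.card (heightPoly.rootSet L) = 8 := by
  rw [Nat.card_eq_fintype_card, card_rootSet_eq_natDegree heightPoly_separable
    (IsSplittingField.splits L heightPoly), natDegree_heightPoly]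

theorem card_filter_isRoot_le {X K : Type*} [Fintype X] [Field K] {ρ : X → K}
    (hρ : Function.Injective ρ) {q : K[X]} (hq : q ≠ 0) [DecidablePred fun x ↦ q.IsRoot (ρ x)] :
    (Finset.univ.filter fun x ↦ q.IsRoot (ρ x)).card ≤ q.natDegree := by
  rw [← Finset.card_map ⟨ρ, hρ⟩]
  apply card_le_degree_of_subset_roots
  intro y hy
  rw [Finset.mem_val, Finset.mem_map] at hy
  obtain ⟨x, hx, rfl⟩ := hy
  exact (mem_roots hq).mpr (Finset.mem_filter.mp hx).2

open Classical in
theorem exists_galois_pow_isSwap [FiniteDimensional ℚ L] [IsGalois ℚ L]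
    [IsSplittingField ℚ L heightPoly] :
    ∃ σ : Gal(L/ℚ),
      (MulAction.toPermHom Gal(L/ℚ) (heightPoly.rootSet L) σ ^ 5).IsSwap ∧
      ∃ x, (MulAction.toPermHom Gal(L/ℚ) (heightPoly.rootSet L) σ ^ 2) x ≠ x := by
  have : Fact (Nat.Prime 11) := ⟨by norm_num⟩
  obtain ⟨K, hK, hKp, ρ, σ, hρ, hσ, hinj⟩ := exists_frobenius_on_roots (L := L) 11
  refine ⟨σ, ?_⟩
  set s := MulAction.toPermHom Gal(L/ℚ) (heightPoly.rootSet L) σ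
  have hs (k : ℕ) (x) : ρ ((s ^ k) x) = (fun y : K ↦ y ^ 11)^[k] (ρ x) := by
    rw [← Equiv.Perm.iterate_eq_pow]
    exact (hσ.iterate_right k) x
  have hρinj : Function.Injective ρ := by
    intro x y h
    by_contra hxy
    have hx := hρ x
    rw [aeval_heightResolvent] at hx
    apply derivative_ne_zero_of_root hx
    rw [← hinj x y hxy h]
    simp [heightResolvent, aeval_def]
    ring
  let l : K[X] := X - 5
  let q : K[X] := X ^ 2 + 5 * X + 1
  let r : K[X] := X ^ 5 - 3 * X ^ 4 - 5 * X ^ 3 - 4 * X - 4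
  have hl : l.natDegree = 1 := by unfold l; compute_degree!
  have hq : q.natDegree = 2 := by unfold q; compute_degree!
  have hr : r.natDegree = 5 := by unfold r; compute_degree!
  have hl0 : l ≠ 0 := by rintro h; simp [h] at hl
  have hq0 : q ≠ 0 := by rintro h; simp [h] at hq
  have hr0 : r ≠ 0 := by rintro h; simp [h] at hr
  have hcl := card_filter_isRoot_le hρinj hl0
  have hcq := card_filter_isRoot_le hρinj hq0
  have hcr := card_filter_isRoot_le hρinj hr0
  have hroot (x) : l.IsRoot (ρ x) ∨ q.IsRoot (ρ x) ∨ r.IsRoot (ρ x) := by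
    have hx := hρ x
    rw [aeval_heightResolvent, resolvent_factor_eleven, mul_eq_zero, mul_eq_zero, or_assoc] at hx
    simpa [l, q, r] using hx
  have hlin (x) (hx : l.IsRoot (ρ x)) : (s ^ 5) x = x := by
    apply hρinj
    rw [hs]
    have hp : (11 : K) = 0 := by exact_mod_cast CharP.cast_eq_zero K 11
    have h5 : ρ x = 5 := by simpa [l, sub_eq_zero] using hx
    apply Function.iterate_fixed
    rw [h5]
    -- 5 ^ 11 - 5 = 11 * 4438920.
    linear_combination (4438920 : K) * hp
  have hquad (x) (hx : q.IsRoot (ρ x)) : (s ^ 5) x ≠ x := by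
    intro h
    obtain ⟨h2, h1⟩ := iterate_pow_eleven_of_quadratic (b := ρ x) (by simpa [q] using hx)
    rw [← hs] at h2 h1
    have h2' := hρinj h2
    apply h1
    congr 1
    -- On a point fixed by `s ^ 2`, the powers `s ^ 5` and `s` agree.
    calc (s ^ 1) x = (s ^ 1) ((s ^ 2) ((s ^ 2) x)) := by rw [h2', h2']
      _ = (s ^ 5) x := rfl
      _ = x := h
  have hquint (x) (hx : r.IsRoot (ρ x)) : (s ^ 5) x = x ∧ (s ^ 2) x ≠ x := by
    obtain ⟨h5, h2⟩ := iterate_pow_eleven_of_quintic (b := ρ x) (by simpa [r] using hx)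
    rw [← hs] at h5 h2
    exact ⟨hρinj h5, fun h ↦ h2 (by rw [h])⟩
  have hcard : Fintype.card (heightPoly.rootSet L) = 8 := by
    rw [← Nat.card_eq_fintype_card, card_rootSet_heightPoly]
  -- The three counts are at most 1, 2 and 5 and their sum is at least 8, so each bound is attained.
  have hunion : Fintype.card (heightPoly.rootSet L) ≤
      (Finset.univ.filter fun x ↦ l.IsRoot (ρ x)).card +
        ((Finset.univ.filter fun x ↦ q.IsRoot (ρ x)).card +
        (Finset.univ.filter fun x ↦ r.IsRoot (ρ x)).card) := by
    rw [← Finset.card_univ]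
    refine le_trans (Finset.card_le_card ?_) ((Finset.card_union_le _ _).trans
      (Nat.add_le_add_left (Finset.card_union_le _ _) _))
    intro x _
    simpa using hroot x
  have hsupp : (s ^ 5).support = Finset.univ.filter fun x ↦ q.IsRoot (ρ x) := by
    ext x
    rw [Equiv.Perm.mem_support, Finset.mem_filter]
    refine ⟨fun h ↦ ⟨Finset.mem_univ _, ?_⟩, fun h ↦ hquad x h.2⟩
    rcases hroot x with hx | hx | hx
    exacts [absurd (hlin x hx) h, hx, absurd (hquint x hx).1 h]
  refine ⟨?_, ?_⟩
  · rw [← Equiv.Perm.card_support_eq_two, hsupp]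
    omega
  · have hpos : 0 < (Finset.univ.filter fun x ↦ r.IsRoot (ρ x)).card := by omega
    obtain ⟨x, hx⟩ := Finset.card_pos.mp hpos
    exact ⟨x, (hquint x (Finset.mem_filter.mp hx).2).2⟩

theorem isPretransitive_and_range_toPermHom_eq_top [FiniteDimensional ℚ L] [IsGalois ℚ L]
    [IsSplittingField ℚ L heightPoly] :
    MulAction.IsPretransitive Gal(L/ℚ) (heightPoly.rootSet L) ∧
      (MulAction.toPermHom Gal(L/ℚ) (heightPoly.rootSet L)).range = ⊤ := by
  classical
  obtain ⟨σ, hσ⟩ := exists_galois_without_short_cycles (L := L)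
  obtain ⟨τ, hτ, hτ'⟩ := exists_galois_pow_isSwap (L := L)
  have h := Equiv.Perm.eq_top_of_card_eq_eight card_rootSet_heightPoly
    (MulAction.toPermHom Gal(L/ℚ) (heightPoly.rootSet L)).range ⟨σ, rfl⟩ ⟨τ, rfl⟩
    (fun x ↦ hσ x 1 (by simp)) (fun x ↦ hσ x 2 (by simp)) (fun x ↦ hσ x 3 (by simp)) hτ hτ'
  refine ⟨⟨fun x y ↦ ?_⟩, h⟩
  obtain ⟨g, hg⟩ := (h ▸ Subgroup.mem_top (Equiv.swap x y) :
    Equiv.swap x y ∈ (MulAction.toPermHom Gal(L/ℚ) (heightPoly.rootSet L)).range)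
  exact ⟨g, (DFunLike.congr_fun hg x).trans (Equiv.swap_apply_left x y)⟩

theorem toPermHom_rootSet_injective [IsSplittingField ℚ L heightPoly] :
    Function.Injective (MulAction.toPermHom Gal(L/ℚ) (heightPoly.rootSet L)) := by
  intro σ τ h
  apply AlgEquiv.coe_toAlgHom_injective
  apply AlgHom.ext_of_adjoin_eq_top (IsSplittingField.adjoin_rootSet L heightPoly)
  intro x hx
  exact congrArg Subtype.val (DFunLike.congr_fun h ⟨x, hx⟩)

theorem irreducible_heightPoly_of_isSplittingField [IsSplittingField ℚ L heightPoly] :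
    Irreducible heightPoly := by
  have : FiniteDimensional ℚ L := IsSplittingField.finiteDimensional L heightPoly
  have : IsGalois ℚ L := IsGalois.of_separable_splitting_field heightPoly_separable
  have htrans := (isPretransitive_and_range_toPermHom_eq_top (L := L)).1
  have hcard := card_rootSet_heightPoly (L := L)
  have : Nonempty (heightPoly.rootSet L) := (Nat.card_pos_iff.mp (by omega)).1
  obtain ⟨x⟩ := this
  have hint : IsIntegral ℚ (x : L) := .of_finite ℚ _
  have hdvd : minpoly ℚ (x : L) ∣ heightPoly := minpoly.dvd _ _ (mem_rootSet.mp x.2).2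
  -- Transitivity makes all 8 roots conjugate to `x`, so its minimal polynomial has full degree.
  have hsub : heightPoly.rootSet L ⊆ (minpoly ℚ (x : L)).rootSet L := by
    intro y hy
    obtain ⟨g, hg⟩ := htrans.exists_smul_eq x ⟨y, hy⟩
    have hg' : g (x : L) = y := congrArg Subtype.val hg
    refine mem_rootSet.mpr ⟨minpoly.ne_zero hint, ?_⟩
    have h := aeval_algHom_apply g.toAlgHom (x : L) (minpoly ℚ (x : L))
    rw [minpoly.aeval, map_zero] at h
    rwa [← hg']
  have hle : 8 ≤ (minpoly ℚ (x : L)).natDegree := by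
    rw [← hcard, Nat.card_coe_set_eq]
    exact (Set.ncard_le_ncard hsub (Set.toFinite _)).trans (ncard_rootSet_le _ _)
  have hassoc := associated_of_dvd_of_natDegree_le hdvd heightPoly_ne_zero
    (natDegree_heightPoly.trans_le hle)
  exact hassoc.irreducible (minpoly.irreducible hint)

end SplittingField

theorem exists_isSplittingField_heightPoly : ∃ (L : Type) (_ : Field L) (_ : Algebra ℚ L),
    IsSplittingField ℚ L heightPoly :=
  ⟨heightPoly.SplittingField, _, _, IsSplittingField.splittingField heightPoly⟩

theorem irreducible_heightPoly : Irreducible heightPoly := by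
  obtain ⟨L, _, _, _⟩ := exists_isSplittingField_heightPoly
  exact irreducible_heightPoly_of_isSplittingField (L := L)

theorem nonempty_gal_heightPoly_mulEquiv :
    Nonempty (heightPoly.Gal ≃* Equiv.Perm (Fin 8)) := by
  obtain ⟨L, _, _, _⟩ := exists_isSplittingField_heightPoly
  have : FiniteDimensional ℚ L := IsSplittingField.finiteDimensional L heightPoly
  have : IsGalois ℚ L := IsGalois.of_separable_splitting_field heightPoly_separable
  have hbij : Function.Bijective (MulAction.toPermHom Gal(L/ℚ) (heightPoly.rootSet L)) :=
    ⟨toPermHom_rootSet_injective,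
      MonoidHom.range_eq_top.mp isPretransitive_and_range_toPermHom_eq_top.2⟩
  have e : heightPoly.rootSet L ≃ Fin 8 := Finite.equivFinOfCardEq card_rootSet_heightPoly
  exact ⟨((IsSplittingField.algEquiv L heightPoly).symm.autCongr.trans
    (MulEquiv.ofBijective _ hbij)).trans e.permCongrHom⟩

theorem notMem_solvableByRad_of_aeval_heightPoly {x : ℂ} (hx : aeval x heightPoly = 0) :
    x ∉ solvableByRad ℚ ℂ := by
  intro h
  have hsol := isSolvable_gal_of_irreducible h irreducible_heightPoly hx
  obtain ⟨e⟩ := nonempty_gal_heightPoly_mulEquiv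
  refine Equiv.Perm.not_isSolvable (Fin 8) (by simp; norm_num) ?_
  exact Group.isSolvable_of_surjective (f := e.toMonoidHom) e.surjective

end HorizontalLineCover

/-! ### Attainment of the minimum cost -/

theorem Finset.sum_image_le_sum {ι κ : Type*} [DecidableEq κ] (s : Finset ι) (g : ι → κ)
    (w : κ → ℝ) (v : ι → ℝ) (hv : ∀ i ∈ s, 0 ≤ v i) (h : ∀ i ∈ s, w (g i) ≤ v i) :
    ∑ k ∈ s.image g, w k ≤ ∑ i ∈ s, v i := by
  rw [← Finset.sum_fiberwise_of_maps_to (g := g) (t := s.image g)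
    (fun i hi ↦ Finset.mem_image_of_mem g hi)]
  refine Finset.sum_le_sum fun k hk ↦ ?_
  obtain ⟨i, hi, rfl⟩ := Finset.mem_image.mp hk
  exact (h i hi).trans (Finset.single_le_sum (f := v)
    (fun j hj ↦ hv j (Finset.mem_filter.mp hj).1) (Finset.mem_filter.mpr ⟨hi, rfl⟩))

namespace HorizontalLineCover

/-- The disk `d` is centered on the line `y = t` and covers `S`. -/
def IsEnclosing (S : Finset Plane) (t : ℝ) (d : Plane × ℝ) : Prop :=
  0 ≤ d.2 ∧ d.1 1 = t ∧ ∀ p ∈ S, dist d.1 p ≤ d.2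

theorem isClosed_setOf_isEnclosing (S : Finset Plane) (t : ℝ) :
    IsClosed {d | IsEnclosing S t d} := by
  have h1 : IsClosed {d : Plane × ℝ | 0 ≤ d.2} := isClosed_le continuous_const continuous_snd
  have h2 : IsClosed {d : Plane × ℝ | d.1 1 = t} :=
    isClosed_eq (by fun_prop) continuous_const
  have h3 : IsClosed {d : Plane × ℝ | ∀ p ∈ S, dist d.1 p ≤ d.2} := by
    simp only [Set.ofPred_forall]
    exact isClosed_biInter fun p _ ↦ isClosed_le (by fun_prop) continuous_snd
  exact h1.inter (h2.inter h3)

theorem exists_minimal_isEnclosing (S : Finset Plane) (t : ℝ) :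
    ∃ d, IsEnclosing S t d ∧ ∀ e, IsEnclosing S t e → d.2 ≤ e.2 := by
  rcases S.eq_empty_or_nonempty with rfl | ⟨p, hp⟩
  · exact ⟨(!₂[0, t], 0), by simp [IsEnclosing], fun e he ↦ he.1⟩
  · let c : Plane := !₂[0, t]
    let R : ℝ := ∑ q ∈ S, dist c q
    have hc : IsEnclosing S t (c, R) :=
      ⟨Finset.sum_nonneg fun _ _ ↦ dist_nonneg, by simp [c],
        fun q hq ↦ Finset.single_le_sum (f := fun q ↦ dist c q) (fun _ _ ↦ dist_nonneg) hq⟩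
    have hK : IsCompact ((Metric.closedBall p R ×ˢ Set.Icc 0 R) ∩ {d | IsEnclosing S t d}) :=
      ((isCompact_closedBall p R).prod isCompact_Icc).inter_right (isClosed_setOf_isEnclosing S t)
    have hmem (e) (he : IsEnclosing S t e) (heR : e.2 ≤ R) :
        e ∈ (Metric.closedBall p R ×ˢ Set.Icc 0 R) ∩ {d | IsEnclosing S t d} :=
      ⟨⟨(he.2.2 p hp).trans heR, he.1, heR⟩, he⟩
    obtain ⟨d, hd, hmin⟩ := hK.exists_isMinOn ⟨_, hmem _ hc le_rfl⟩ continuous_snd.continuousOn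
    refine ⟨d, hd.2, fun e he ↦ ?_⟩
    by_cases heR : e.2 ≤ R
    · exact hmin (hmem e he heR)
    · exact hd.1.2.2.trans (not_le.mp heR).le

/-- Only the subsets of `Y` that the disks cover matter. Replacing each disk by a smallest one
enclosing its subset leaves finitely many candidate families. -/
theorem isLeast_minCost {Y : Set Plane} (hY : Y.Finite) (t : ℝ) :
    IsLeast (coverCosts Y t) (minCost Y t) := by
  classical
  lift Y to Finset Plane using hY
  choose m hm hmin using fun S ↦ exists_minimal_isEnclosing S t
  let F : Finset (Finset (Finset Plane)) :=
    Y.powerset.powerset.filter fun P ↦ ∀ p ∈ Y, ∃ S ∈ P, p ∈ S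
  have hF : F.Nonempty := ⟨{Y}, by simp [F]⟩
  obtain ⟨P, hP, hPmin⟩ := F.exists_min_image (fun P ↦ ∑ S ∈ P, (m S).2) hF
  have hcover : IsCover Y t (P.image m) := by
    refine ⟨fun d hd ↦ ?_, fun d hd ↦ ?_, fun p hp ↦ ?_⟩
    · obtain ⟨S, -, rfl⟩ := Finset.mem_image.mp hd
      exact (hm S).1
    · obtain ⟨S, -, rfl⟩ := Finset.mem_image.mp hd
      exact (hm S).2.1
    · obtain ⟨S, hS, hpS⟩ := (Finset.mem_filter.mp hP).2 p hp
      exact ⟨m S, Finset.mem_image_of_mem m hS, (hm S).2.2 p hpS⟩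
  have hleast : IsLeast (coverCosts Y t) (∑ d ∈ P.image m, d.2) := by
    refine ⟨⟨_, hcover, rfl⟩, ?_⟩
    rintro _ ⟨D, hD, rfl⟩
    let g : Plane × ℝ → Finset Plane := fun d ↦ Y.filter fun p ↦ dist d.1 p ≤ d.2
    have hgF : D.image g ∈ F := by
      refine Finset.mem_filter.mpr ⟨Finset.mem_powerset.mpr fun S hS ↦ ?_, fun p hp ↦ ?_⟩
      · obtain ⟨d, -, rfl⟩ := Finset.mem_image.mp hS
        exact Finset.mem_powerset.mpr (Finset.filter_subset _ _)
      · obtain ⟨d, hd, hdp⟩ := hD.covers p hp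
        exact ⟨g d, Finset.mem_image_of_mem g hd, Finset.mem_filter.mpr ⟨hp, hdp⟩⟩
    calc ∑ d ∈ P.image m, d.2
        ≤ ∑ S ∈ P, (m S).2 :=
          P.sum_image_le_sum m _ _ (fun S _ ↦ (hm S).1) fun _ _ ↦ le_rfl
      _ ≤ ∑ S ∈ D.image g, (m S).2 := hPmin _ hgF
      _ ≤ ∑ d ∈ D, d.2 := D.sum_image_le_sum g _ _ hD.radius_nonneg fun d hd ↦
          hmin _ d ⟨hD.radius_nonneg d hd, hD.center_on_line d hd,
            fun p hp ↦ (Finset.mem_filter.mp hp).2⟩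
  rw [minCost, hleast.csInf_eq]
  exact hleast

/-! ### Bounds for the five clients -/

theorem clients_finite : clients.Finite := by simp [clients]

theorem ncard_clients : clients.ncard = 5 := by
  have hne {a b c d : ℝ} (h : a ≠ c) : (!₂[a, b] : Plane) ≠ !₂[c, d] :=
    fun h' ↦ h (congrArg (fun p : Plane ↦ p 0) h')
  rw [clients, Set.ncard_insert_of_notMem, Set.ncard_insert_of_notMem,
    Set.ncard_insert_of_notMem, Set.ncard_pair (hne (by norm_num))]
  all_goals
    simp only [Set.mem_insert_iff, Set.mem_singleton_iff, not_or]
    repeat' apply And.intro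
    all_goals exact hne (by norm_num)

theorem dist_le_iff_sq (c : Plane) (a b : ℝ) {r : ℝ} (hr : 0 ≤ r) :
    dist c !₂[a, b] ≤ r ↔ (c 0 - a) ^ 2 + (c 1 - b) ^ 2 ≤ r ^ 2 := by
  rw [EuclideanSpace.dist_eq, Real.sqrt_le_left hr]
  simp [Fin.sum_univ_two, Real.dist_eq, sq_abs]

theorem abs_sub_le_of_dist_le {c : Plane} {a b r : ℝ} (h : dist c !₂[a, b] ≤ r) :
    |c 0 - a| ≤ r ∧ |c 1 - b| ≤ r := by
  have hr : 0 ≤ r := dist_nonneg.trans h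
  rw [dist_le_iff_sq _ _ _ hr] at h
  exact ⟨abs_le_of_sq_le_sq (by nlinarith [sq_nonneg (c 1 - b)]) hr,
    abs_le_of_sq_le_sq (by nlinarith [sq_nonneg (c 0 - a)]) hr⟩

/-- A single disk does best on the perpendicular bisector, at abscissa `m - (t - k)`; two disks cost
at least the vertical gap `2 * w`, which is no less when `|t - k| ≤ w`. -/
theorem sqrt_le_sum_pair [DecidableEq (Plane × ℝ)] {d e : Plane × ℝ} {t m k w : ℝ}
    (hdt : d.1 1 = t) (het : e.1 1 = t)
    (hd : dist d.1 !₂[m + w, k + w] ≤ d.2) (he : dist e.1 !₂[m - w, k - w] ≤ e.2)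
    (ht : |t - k| ≤ w) :
    √(2 * (t - k) ^ 2 + 2 * w ^ 2) ≤ ∑ x ∈ {d, e}, x.2 := by
  have hd0 : 0 ≤ d.2 := dist_nonneg.trans hd
  obtain ⟨h1, h2⟩ := abs_le.mp ht
  by_cases hde : d = e
  · subst hde
    rw [Finset.pair_eq_singleton, Finset.sum_singleton]
    rw [dist_le_iff_sq _ _ _ hd0, hdt] at hd he
    refine Real.sqrt_le_iff.mpr ⟨hd0, ?_⟩
    -- The side of the bisector on which the center lies decides which client is the farther one.
    rcases le_total (d.1 0 - m) (-(t - k)) with h | h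
    · nlinarith [mul_self_le_mul_self (by linarith : 0 ≤ (t - k) + w)
        (by linarith : (t - k) + w ≤ m + w - d.1 0)]
    · nlinarith [mul_self_le_mul_self (by linarith : 0 ≤ w - (t - k))
        (by linarith : w - (t - k) ≤ d.1 0 - m + w)]
  · rw [Finset.sum_pair hde]
    have h3 := (abs_sub_le_of_dist_le hd).2
    have h4 := (abs_sub_le_of_dist_le he).2
    rw [hdt] at h3
    rw [het] at h4
    have h5 : 2 * w ≤ d.2 + e.2 := by linarith [neg_abs_le (t - (k + w)), le_abs_self (t - (k - w))]
    refine le_trans (Real.sqrt_le_iff.mpr ⟨by linarith, ?_⟩) h5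
    nlinarith

/-- The cost of the optimal covers on the lines `y = t` with `|t| ≤ 2`. -/
noncomputable def heightCost (t : ℝ) : ℝ := √(2 * (t - 1) ^ 2 + 18) + √(2 * t ^ 2 + 8) + (2 - t)

theorem cost_lower_bound {t : ℝ} {D : Finset (Plane × ℝ)} (hD : IsCover clients t D) :
    8.4 ≤ ∑ d ∈ D, d.2 ∨ |t| ≤ 2 ∧ heightCost t ≤ ∑ d ∈ D, d.2 := by
  classical
  obtain ⟨a, ha, hap⟩ := hD.covers !₂[3, 4] (by simp [clients])
  obtain ⟨b, hb, hbp⟩ := hD.covers !₂[-3, -2] (by simp [clients])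
  obtain ⟨c, hc, hcp⟩ := hD.covers !₂[102, 2] (by simp [clients])
  obtain ⟨d, hd, hdp⟩ := hD.covers !₂[98, -2] (by simp [clients])
  obtain ⟨e, he, hep⟩ := hD.covers !₂[200, 2] (by simp [clients])
  have hle (x) (hx : x ∈ D) : x.2 ≤ ∑ d ∈ D, d.2 :=
    Finset.single_le_sum (f := fun d : Plane × ℝ ↦ d.2) hD.radius_nonneg hx
  have hfar {x y : Plane × ℝ} {p q p' q' : ℝ} (hx : x ∈ D) (h1 : dist x.1 !₂[p, q] ≤ x.2)
      (h2 : dist y.1 !₂[p', q'] ≤ y.2) (hpp : p + 40 ≤ p') (hlt : ∑ d ∈ D, d.2 < 8.4) :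
      x ≠ y := by
    rintro rfl
    have := hle x hx
    have h3 := abs_le.mp (abs_sub_le_of_dist_le h1).1
    have h4 := abs_le.mp (abs_sub_le_of_dist_le h2).1
    norm_num at hlt
    linarith [h3.1, h3.2, h4.1, h4.2]
  by_cases hlt : ∑ d ∈ D, d.2 < 8.4
  swap
  · exact Or.inl (not_lt.mp hlt)
  right
  have hac := hfar ha hap hcp (by norm_num) hlt
  have had := hfar ha hap hdp (by norm_num) hlt
  have hae := hfar ha hap hep (by norm_num) hlt
  have hbc := hfar hb hbp hcp (by norm_num) hlt
  have hbd := hfar hb hbp hdp (by norm_num) hlt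
  have hbe := hfar hb hbp hep (by norm_num) hlt
  have hce := hfar hc hcp hep (by norm_num) hlt
  have hde := hfar hd hdp hep (by norm_num) hlt
  have hsum : ∑ x ∈ {a, b}, x.2 + ∑ x ∈ {c, d}, x.2 + e.2 ≤ ∑ d ∈ D, d.2 := by
    have h1 : Disjoint ({a, b} : Finset (Plane × ℝ)) {c, d} := by
      simp [hac.symm, had.symm, hbc.symm, hbd.symm]
    have h2 : Disjoint ({a, b} ∪ {c, d} : Finset (Plane × ℝ)) {e} := by
      simp [hae.symm, hbe.symm, hce.symm, hde.symm]
    rw [← Finset.sum_union h1, ← Finset.sum_singleton (fun x : Plane × ℝ ↦ x.2) e,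
      ← Finset.sum_union h2]
    refine Finset.sum_le_sum_of_subset_of_nonneg ?_ fun x hx _ ↦ hD.radius_nonneg x hx
    intro x hx
    simp only [Finset.mem_union, Finset.mem_insert, Finset.mem_singleton] at hx
    rcases hx with ((rfl | rfl) | rfl | rfl) | rfl <;> assumption
  have hpair {x y z : Plane × ℝ} (hx : x ∈ D) (hy : y ∈ D) (hz : z ∈ ({x, y} : Finset _)) :
      z.2 ≤ ∑ x ∈ {x, y}, x.2 := by
    refine Finset.single_le_sum (f := fun d : Plane × ℝ ↦ d.2) (fun w hw ↦ ?_) hz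
    simp only [Finset.mem_insert, Finset.mem_singleton] at hw
    rcases hw with rfl | rfl <;> exact hD.radius_nonneg _ ‹_›
  have hat := (abs_sub_le_of_dist_le hap).2.trans (hpair ha hb (by simp))
  have hbt := (abs_sub_le_of_dist_le hbp).2.trans (hpair ha hb (by simp))
  have hct := (abs_sub_le_of_dist_le hcp).2.trans (hpair hc hd (by simp))
  have hdt := (abs_sub_le_of_dist_le hdp).2.trans (hpair hc hd (by simp))
  have het := (abs_sub_le_of_dist_le hep).2
  rw [hD.center_on_line _ ‹_›] at hat hbt hct hdt het
  have hab : |t - 1| ≤ 3 → √(2 * (t - 1) ^ 2 + 18) ≤ ∑ x ∈ {a, b}, x.2 := by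
    intro h
    have := sqrt_le_sum_pair (m := 0) (k := 1) (w := 3) (hD.center_on_line a ha)
      (hD.center_on_line b hb) (by norm_num; exact hap) (by norm_num; exact hbp) h
    norm_num at this
    exact this
  have hcd : |t - 0| ≤ 2 → √(2 * t ^ 2 + 8) ≤ ∑ x ∈ {c, d}, x.2 := by
    intro h
    have := sqrt_le_sum_pair (m := 100) (k := 0) (w := 2) (hD.center_on_line c hc)
      (hD.center_on_line d hd) (by norm_num; exact hcp) (by norm_num; exact hdp) h
    norm_num at this
    exact this
  rw [abs_le] at hat hbt hct hdt het
  norm_num at hlt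
  have ht1 : -2 ≤ t := by
    by_contra! h
    linarith [hat.1, hct.1, het.1]
  have ht4 : t ≤ 4 := by
    by_contra! h
    linarith [hbt.2, hdt.2, het.2]
  have hab' := hab (abs_le.mpr ⟨by linarith, by linarith⟩)
  -- Above height 2 the first pair costs at least 4.4 and the second more than 4, which exceeds 8.4
  -- in total.
  have ht2 : t ≤ 2 := by
    by_contra! h
    have : (4.4 : ℝ) ≤ √(2 * (t - 1) ^ 2 + 18) := Real.le_sqrt_of_sq_le (by nlinarith)
    norm_num at this
    linarith [hdt.2, het.2]
  have hcd' := hcd (abs_le.mpr ⟨by linarith, by linarith⟩)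
  refine ⟨abs_le.mpr ⟨ht1, ht2⟩, ?_⟩
  rw [heightCost]
  linarith [het.1]

theorem minCost_le_heightCost {t : ℝ} (ht : t ≤ 2) : minCost clients t ≤ heightCost t := by
  classical
  let g : Fin 3 → Plane × ℝ := ![(!₂[1 - t, t], √(2 * (t - 1) ^ 2 + 18)),
    (!₂[100 - t, t], √(2 * t ^ 2 + 8)), (!₂[200, t], 2 - t)]
  have hnonneg (i : Fin 3) : 0 ≤ (g i).2 := by
    fin_cases i
    exacts [Real.sqrt_nonneg _, Real.sqrt_nonneg _, sub_nonneg.mpr ht]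
  have h1 : 0 ≤ 2 * (t - 1) ^ 2 + 18 := by positivity
  have h2 : 0 ≤ 2 * t ^ 2 + 8 := by positivity
  have hcover : IsCover clients t (Finset.univ.image g) := by
    refine ⟨fun d hd ↦ ?_, fun d hd ↦ ?_, fun p hp ↦ ?_⟩
    · obtain ⟨i, -, rfl⟩ := Finset.mem_image.mp hd
      exact hnonneg i
    · obtain ⟨i, -, rfl⟩ := Finset.mem_image.mp hd
      fin_cases i <;> rfl
    · have hmem (i) : g i ∈ Finset.univ.image g := Finset.mem_image_of_mem g (Finset.mem_univ i)
      rcases hp with rfl | rfl | rfl | rfl | rfl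
      · refine ⟨g 0, hmem 0, (dist_le_iff_sq _ _ _ (hnonneg 0)).mpr ?_⟩
        simp only [g, Matrix.cons_val, PiLp.toLp_apply, Real.sq_sqrt h1]
        linarith
      · refine ⟨g 0, hmem 0, (dist_le_iff_sq _ _ _ (hnonneg 0)).mpr ?_⟩
        simp only [g, Matrix.cons_val, PiLp.toLp_apply, Real.sq_sqrt h1]
        linarith
      · refine ⟨g 1, hmem 1, (dist_le_iff_sq _ _ _ (hnonneg 1)).mpr ?_⟩
        simp only [g, Matrix.cons_val, PiLp.toLp_apply, Real.sq_sqrt h2]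
        linarith
      · refine ⟨g 1, hmem 1, (dist_le_iff_sq _ _ _ (hnonneg 1)).mpr ?_⟩
        simp only [g, Matrix.cons_val, PiLp.toLp_apply, Real.sq_sqrt h2]
        linarith
      · refine ⟨g 2, hmem 2, (dist_le_iff_sq _ _ _ (hnonneg 2)).mpr ?_⟩
        simp only [g, Matrix.cons_val, PiLp.toLp_apply]
        linarith
  calc minCost clients t ≤ ∑ d ∈ Finset.univ.image g, d.2 :=
        (isLeast_minCost clients_finite t).2 ⟨_, hcover, rfl⟩
    _ ≤ ∑ i, (g i).2 :=
        Finset.univ.sum_image_le_sum g _ _ (fun i _ ↦ hnonneg i) fun _ _ ↦ le_rfl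
    _ = heightCost t := by simp [g, Fin.sum_univ_three, heightCost]

/-! ### Convexity and the critical height -/

/-- The strict tangent-line inequality; it reduces to strict Cauchy–Schwarz for (√2 x, √k) and (√2
y, √k). -/
theorem sqrt_add_tangent_lt {x y k : ℝ} (hk : 0 < k) (hxy : x ≠ y) :
    √(2 * y ^ 2 + k) + (x - y) * (2 * y / √(2 * y ^ 2 + k)) < √(2 * x ^ 2 + k) := by
  have hy : 0 < √(2 * y ^ 2 + k) := Real.sqrt_pos.mpr (by positivity)
  have hy2 : √(2 * y ^ 2 + k) ^ 2 = 2 * y ^ 2 + k := Real.sq_sqrt (by positivity)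
  have h : 2 * x * y + k < √(2 * x ^ 2 + k) * √(2 * y ^ 2 + k) := by
    rw [← Real.sqrt_mul (by positivity)]
    apply Real.lt_sqrt_of_sq_lt
    have : 0 < k * (x - y) ^ 2 := mul_pos hk (sq_pos_of_ne_zero (sub_ne_zero.mpr hxy))
    nlinarith
  rw [← div_lt_iff₀ hy] at h
  refine lt_of_eq_of_lt ?_ h
  field_simp
  rw [hy2]
  ring

theorem exists_heightCost_critical : ∃ t : ℝ, 1 ≤ t ∧ t ≤ 2 ∧
    2 * (t - 1) / √(2 * (t - 1) ^ 2 + 18) + 2 * t / √(2 * t ^ 2 + 8) = 1 := by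
  have h1 (t : ℝ) : √(2 * (t - 1) ^ 2 + 18) ≠ 0 := (Real.sqrt_pos.mpr (by positivity)).ne'
  have h2 (t : ℝ) : √(2 * t ^ 2 + 8) ≠ 0 := (Real.sqrt_pos.mpr (by positivity)).ne'
  have hcont : Continuous fun t : ℝ ↦
      2 * (t - 1) / √(2 * (t - 1) ^ 2 + 18) + 2 * t / √(2 * t ^ 2 + 8) := by
    fun_prop (disch := assumption)
  have hmem := intermediate_value_Icc (by norm_num : (1 : ℝ) ≤ 2) hcont.continuousOn
    (show (1 : ℝ) ∈ Set.Icc _ _ from ⟨?_, ?_⟩)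
  · obtain ⟨t, ht, h⟩ := hmem
    exact ⟨t, ht.1, ht.2, h⟩
  · have : (2 : ℝ) ≤ √10 := Real.le_sqrt_of_sq_le (by norm_num)
    norm_num
    rw [div_le_one (by positivity)]
    exact this
  · have h16 : √(16 : ℝ) = 4 := by
      rw [show (16 : ℝ) = 4 ^ 2 by norm_num, Real.sqrt_sq (by norm_num)]
    have : (0 : ℝ) ≤ 2 / √20 := by positivity
    norm_num [h16]
    exact this

theorem aeval_heightPoly_eq_zero_of_critical {t : ℝ}
    (h : 2 * (t - 1) / √(2 * (t - 1) ^ 2 + 18) + 2 * t / √(2 * t ^ 2 + 8) = 1) :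
    Polynomial.aeval t heightPoly = 0 := by
  have hP : 0 < √(2 * (t - 1) ^ 2 + 18) := Real.sqrt_pos.mpr (by positivity)
  have hQ : 0 < √(2 * t ^ 2 + 8) := Real.sqrt_pos.mpr (by positivity)
  have hP2 : √(2 * (t - 1) ^ 2 + 18) ^ 2 = 2 * (t - 1) ^ 2 + 18 := Real.sq_sqrt (by positivity)
  have hQ2 : √(2 * t ^ 2 + 8) ^ 2 = 2 * t ^ 2 + 8 := Real.sq_sqrt (by positivity)
  set P := √(2 * (t - 1) ^ 2 + 18)
  set Q := √(2 * t ^ 2 + 8)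
  rw [div_add_div _ _ hP.ne' hQ.ne', div_eq_one_iff_eq (by positivity)] at h
  -- The first squaring leaves only the product `P * Q` irrational; the second removes it.
  have h2 : P ^ 2 * Q ^ 2 - (2 * (t - 1)) ^ 2 * Q ^ 2 - (2 * t) ^ 2 * P ^ 2 =
      2 * (2 * (t - 1)) * (2 * t) * (P * Q) := by
    linear_combination -(2 * (t - 1) * Q + P * (2 * t) + P * Q) * h
  have h3 := congrArg (· ^ 2) h2
  simp only [mul_pow _ (P * Q), mul_pow P Q] at h3
  rw [hP2, hQ2] at h3
  rw [aeval_heightPoly]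
  linear_combination h3 / 16

theorem heightCost_lt_of_critical {t₀ t : ℝ} (htt : t ≠ t₀)
    (h : 2 * (t₀ - 1) / √(2 * (t₀ - 1) ^ 2 + 18) + 2 * t₀ / √(2 * t₀ ^ 2 + 8) = 1) :
    heightCost t₀ < heightCost t := by
  have h1 := sqrt_add_tangent_lt (x := t - 1) (y := t₀ - 1) (k := 18) (by norm_num)
    (fun h' ↦ htt (by linarith))
  have h2 := sqrt_add_tangent_lt (x := t) (y := t₀) (k := 8) (by norm_num) htt
  rw [heightCost, heightCost]
  linear_combination h1 + h2 - (t - t₀) * h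

theorem heightCost_seven_fifths_lt : heightCost (7 / 5) < 8.4 := by
  have h1 : √(2 * ((7 / 5 : ℝ) - 1) ^ 2 + 18) < 4.3 := (Real.sqrt_lt' (by norm_num)).mpr (by
    norm_num)
  have h2 : √(2 * (7 / 5 : ℝ) ^ 2 + 8) < 3.5 := (Real.sqrt_lt' (by norm_num)).mpr (by norm_num)
  rw [heightCost]
  linarith

end HorizontalLineCover

theorem mainTheorem3 :
    HorizontalLineCover.clients.ncard = 5 ∧
    (∀ t : ℝ, IsLeast (HorizontalLineCover.coverCosts HorizontalLineCover.clients t)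
      (HorizontalLineCover.minCost HorizontalLineCover.clients t)) ∧
    (∃ t₀ : ℝ,
      (∀ t : ℝ, t ≠ t₀ →
        HorizontalLineCover.minCost HorizontalLineCover.clients t₀ <
          HorizontalLineCover.minCost HorizontalLineCover.clients t) ∧
      Polynomial.aeval t₀ HorizontalLineCover.heightPoly = 0 ∧
      (t₀ : ℂ) ∉ solvableByRad ℚ ℂ) ∧
    HorizontalLineCover.heightPoly.natDegree = 8 ∧
    Nonempty (HorizontalLineCover.heightPoly.Gal ≃* Equiv.Perm (Fin 8)) := by
  have hleast := HorizontalLineCover.isLeast_minCost HorizontalLineCover.clients_finite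
  refine ⟨HorizontalLineCover.ncard_clients, hleast, ?_, HorizontalLineCover.natDegree_heightPoly,
    HorizontalLineCover.nonempty_gal_heightPoly_mulEquiv⟩
  obtain ⟨t₀, -, ht₀, hcrit⟩ := HorizontalLineCover.exists_heightCost_critical
  have hroot := HorizontalLineCover.aeval_heightPoly_eq_zero_of_critical hcrit
  refine ⟨t₀, fun t htt ↦ ?_, hroot, ?_⟩
  · refine (HorizontalLineCover.minCost_le_heightCost ht₀).trans_lt ?_
    obtain ⟨D, hD, hcost⟩ := (hleast t).1
    rw [hcost]
    rcases HorizontalLineCover.cost_lower_bound hD with h | ⟨-, h⟩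
    -- The height 7/5 is only a rational test point, near enough to the optimum to beat 8.4.
    · refine lt_of_le_of_lt ?_ (HorizontalLineCover.heightCost_seven_fifths_lt.trans_le h)
      rcases eq_or_ne (7 / 5) t₀ with rfl | h'
      exacts [le_rfl, (HorizontalLineCover.heightCost_lt_of_critical h' hcrit).le]
    · exact (HorizontalLineCover.heightCost_lt_of_critical htt hcrit).trans_le h
  · apply HorizontalLineCover.notMem_solvableByRad_of_aeval_heightPoly
    have h := congrArg (fun x : ℝ ↦ (x : ℂ)) hroot
    rw [HorizontalLineCover.aeval_heightPoly] at h ⊢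
    simpa using h
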